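/- Let $(\mathcal X,\mathcal B)$ be a measurable space and let $\mathcal H$ be a reproducing kernel Hilbert space of real functions on $\mathcal X$ with measurable reproducing kernel $h$ and feature map $\psi(x)=h(x,\cdot)$. For a probability distribution $P$ on $\mathcal X$ let $\mu_h(P)=\mathbb E_{X\sim P}[\psi(X)]\in\mathcal H$ be its kernel mean embedding, and let $\mathcal V_h(P,Q)=\|\mu_h(P)-\mu_h(Q)\|_{\mathcal H}$ be the maximum mean discrepancy. Let $K\ge 2$, let $n_1,\dots,n_K\ge 1$, $N=\sum_k n_k$, $n_{\min}=\min_k n_k$, $n_{\max}=\max_k n_k$, and let $X_{1,k},\dots,X_{n_k,k}\sim P_k$ $(k=1,\dots,K)$ be mutually independent samples, pooled as $(Z_1,\dots,Z_N)=(X_{1,1},\dots,X_{n_K,K})$. Put $$\widehat{\mathcal V}_{h,\max}=\max_{1\le k<l\le K}\Big\|\frac1{n_k}\sum_{i=1}^{n_k}\psi(X_{i,k})-\frac1{n_l}\sum_{j=1}^{n_l}\psi(X_{j,l})\Big\|_{\mathcal H},$$ let $\widehat{\mathcal V}^{(\boldsymbol b)}_{h,\max}$ be the same statistic computed from the permuted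 data $(Z_{b_1},\dots,Z_{b_N})$, and let $$p_{\mathrm{perm}}=\frac1{N!}\sum_{\boldsymbol b}\mathbf 1\big(\widehat{\mathcal V}^{(\boldsymbol b)}_{h,\max}\ge\widehat{\mathcal V}_{h,\max}\big),\qquad \phi_{K,\mathrm{perm}}=\mathbf 1(p_{\mathrm{perm}}\le\alpha),$$ where the sum is over all permutations $\boldsymbol b$ of $\{1,\dots,N\}$ and $\alpha\in(0,1)$ is fixed. Let $r_N^\star=\sqrt{\log K/n_{\min}}$ and, for $\epsilon\in\mathbb R$, let $$\mathcal F_h(\epsilon)=\Big\{(P_1,\dots,P_K):\ \max_{1\le k<l\le K}\mathcal V_h(P_k,P_l)\ge\epsilon\Big\},$$ where $P_1,\dots,P_K$ range over all probability distributions on $(\mathcal X,\mathcal B)$. Assume that there is a constant $B$ with $0\le h(x,y)\le B$ for all $x,y\in\mathcal X$, and consider any sequence of designs $(K;n_1,\dots,n_K)$, where $K\ge2$ may be fixed or vary along the sequence, such that $n_{\max}/n_{\min}\le c$ along the sequence for a fixed constant $c>0$, and $n_{\min}\to\infty$. Then for every sequence $b_N$ that tends to infinity along this sequence of designs, $$\limsup_{n_{\min}\to\infty}\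 \sup_{(P_1,\dots,P_K)\in\mathcal F_h(b_N r_N^\star)}\mathbb P\big(\phi_{K,\mathrm{perm}}=0\big)=0 .$$ (The supremum over an empty class is $0$.) -/

import Mathlib

open MeasureTheory Filter Topology
open scoped ENNReal

noncomputable section

namespace KSampleMMD

section Kernel

variable {𝒳 : Type*} (H : Type*) [NormedAddCommGroup H] [InnerProductSpace ℝ H] [CompleteSpace H]
  [RKHS ℝ H 𝒳 ℝ]

/-- The canonical feature map `ψ x = h(x, ·)` of the reproducing kernel Hilbert space `H`. -/
def featureMap (x : 𝒳) : H := RKHS.kerFun H x (1 : ℝ)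

/-- The (real-valued) reproducing kernel `h` of `H`. -/
def kernelFun (x y : 𝒳) : ℝ := RKHS.kernel H x y (1 : ℝ)

theorem inner_featureMap (x : 𝒳) (f : H) : inner ℝ (featureMap H x) f = f x := by
  rw [featureMap, RKHS.kerFun_inner]; simp

theorem featureMap_apply (x y : 𝒳) : featureMap H y x = kernelFun H x y :=
  RKHS.kerFun_apply H y 1 x

theorem kernelFun_eq_inner (x y : 𝒳) :
    kernelFun H x y = inner ℝ (featureMap H x) (featureMap H y) := by
  rw [inner_featureMap, featureMap_apply]

variable [MeasurableSpace 𝒳]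

variable {H} in
/-- `m` is the kernel mean embedding `E_{X ∼ P}[ψ(X)]` of `P`, the expectation being taken in the
weak sense: `⟨m, f⟩ = E_{X ∼ P}[f(X)]` for every `f` in `H`. -/
def IsMeanEmbedding (P : Measure 𝒳) (m : H) : Prop :=
  ∀ f : H, Integrable (fun x => f x) P ∧ inner ℝ m f = ∫ x, f x ∂P

open Classical in
/-- The kernel mean embedding `μ_h(P)`; it is `0` when the weak expectation does not exist. -/
def meanEmbedding (P : Measure 𝒳) : H :=
  if hP : ∃ m : H, IsMeanEmbedding P m then hP.choose else 0

set_option linter.unusedSectionVars false in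
variable {H} in
theorem IsMeanEmbedding.eq_meanEmbedding {P : Measure 𝒳} {m : H} (hm : IsMeanEmbedding P m) :
    m = meanEmbedding H P := by
  have hex : ∃ m : H, IsMeanEmbedding P m := ⟨m, hm⟩
  rw [meanEmbedding, dif_pos hex]
  refine ext_inner_right ℝ fun f => ?_
  rw [(hm f).2, (hex.choose_spec f).2]

/-- Where the feature map is Bochner integrable, the mean embedding is its Bochner integral. -/
theorem meanEmbedding_eq_integral {P : Measure 𝒳} (hP : Integrable (featureMap H) P) :
    meanEmbedding H P = ∫ x, featureMap H x ∂P := by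
  have hm : IsMeanEmbedding P (∫ x, featureMap H x ∂P) := fun f => by
    have h1 : (fun x => f x) = fun x => inner ℝ (featureMap H x) f := by
      funext x
      rw [inner_featureMap]
    rw [h1]
    refine ⟨hP.inner_const f, ?_⟩
    rw [real_inner_comm, ← integral_inner hP f]
    exact integral_congr_ae (ae_of_all _ fun x => real_inner_comm _ _)
  exact hm.eq_meanEmbedding.symm

/-- With a measurable kernel every element of `H` is a measurable function. -/
theorem measurable_coe (hmeas : Measurable fun p : 𝒳 × 𝒳 => kernelFun H p.1 p.2) (f : H) :
    Measurable fun x => f x := by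
  revert f
  obtain ⟨S, hS⟩ : ∃ S : Submodule ℝ H, ∀ f : H, f ∈ S ↔ Measurable fun x => f x := by
    refine ⟨
      { carrier := {f | Measurable fun x => f x}
        add_mem' := fun {f g} hf hg => by
          change Measurable ((f + g : H) : 𝒳 → ℝ)
          rw [RKHS.coe_add]
          exact Measurable.add hf hg
        zero_mem' := by
          change Measurable ((0 : H) : 𝒳 → ℝ)
          rw [RKHS.coe_zero]
          exact measurable_zero
        smul_mem' := fun c f hf => by
          change Measurable ((c • f : H) : 𝒳 → ℝ)
          rw [RKHS.coe_smul]
          exact Measurable.const_smul hf c }, fun f => Iff.rfl⟩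
  have hclosed : IsClosed (S : Set H) := by
    refine IsSeqClosed.isClosed fun u f hu hlim => ?_
    refine (hS f).2 (measurable_of_tendsto_metrizable (f := fun k x => u k x) (fun k => (hS _).1 (hu k)) ?_)
    exact tendsto_pi_nhds.2 fun x => ((RKHS.continuous_eval x).tendsto f).comp hlim
  have hsub : Submodule.span ℝ {RKHS.kerFun H x v | (x : 𝒳) (v : ℝ)} ≤ S := by
    refine Submodule.span_le.2 ?_
    rintro _ ⟨x, v, rfl⟩
    have hx : RKHS.kerFun H x v = v • featureMap H x := by
      rw [featureMap, ← ContinuousLinearMap.map_smul, smul_eq_mul, mul_one]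
    rw [hx]
    have hm : Measurable fun y => featureMap H x y := by
      have he : (fun y => featureMap H x y) = fun y => kernelFun H y x :=
        funext fun y => featureMap_apply H y x
      rw [he]
      have hp : Measurable fun y : 𝒳 => (y, x) := measurable_id.prodMk measurable_const
      have hc : (fun y => kernelFun H y x) =
          (fun p : 𝒳 × 𝒳 => kernelFun H p.1 p.2) ∘ fun y : 𝒳 => (y, x) := rfl
      rw [hc]
      exact hmeas.comp hp
    exact S.smul_mem v ((hS _).2 hm)
  have htop : (⊤ : Submodule ℝ H) ≤ S := by
    rw [← RKHS.kerFun_dense H]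
    exact Submodule.topologicalClosure_minimal _ hsub hclosed
  exact fun f => (hS f).1 <| htop (Submodule.mem_top (x := f))

/-- For a bounded measurable kernel the mean embedding of every probability distribution exists. -/
theorem isMeanEmbedding_meanEmbedding {B : ℝ} (hB : ∀ x : 𝒳, kernelFun H x x ≤ B)
    (hmeas : Measurable fun p : 𝒳 × 𝒳 => kernelFun H p.1 p.2)
    (P : Measure 𝒳) [IsProbabilityMeasure P] : IsMeanEmbedding P (meanEmbedding H P) := by
  have hf := measurable_coe H hmeas
  have hbd : ∀ (f : H) (x : 𝒳), ‖f x‖ ≤ √B * ‖f‖ := fun f x => by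
    rw [← inner_featureMap H x f]
    refine (norm_inner_le_norm _ _).trans (mul_le_mul_of_nonneg_right ?_ (norm_nonneg f))
    refine Real.le_sqrt_of_sq_le ?_
    rw [← real_inner_self_eq_norm_sq, ← kernelFun_eq_inner]
    exact hB x
  have hint : ∀ f : H, Integrable (fun x => f x) P := fun f =>
    Integrable.of_bound (hf f).aestronglyMeasurable _ (ae_of_all _ (hbd f))
  let L : H →ₗ[ℝ] ℝ :=
    { toFun := fun f => ∫ x, f x ∂P
      map_add' := fun f g => by
        simp only [RKHS.coe_add, Pi.add_apply]
        exact integral_add (hint f) (hint g)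
      map_smul' := fun c f => by
        simp only [RKHS.coe_smul, Pi.smul_apply, RingHom.id_apply]
        exact integral_smul c _ }
  let Lc : H →L[ℝ] ℝ := L.mkContinuous (√B) fun f => by
    have h := norm_integral_le_of_norm_le_const (μ := P) (ae_of_all _ (hbd f))
    rw [probReal_univ, mul_one] at h
    exact h
  have hex : ∃ m : H, IsMeanEmbedding P m :=
    ⟨(InnerProductSpace.toDual ℝ H).symm Lc, fun f =>
      ⟨hint f, by rw [InnerProductSpace.toDual_symm_apply]; rfl⟩⟩
  rw [meanEmbedding, dif_pos hex]
  exact hex.choose_spec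

/-- The maximum mean discrepancy `𝒱_h(P, Q) = ‖μ_h(P) - μ_h(Q)‖_H`. -/
def mmd (P Q : Measure 𝒳) : ℝ := ‖meanEmbedding H P - meanEmbedding H Q‖

end Kernel

/-- The pairs `1 ≤ k < l ≤ K`. -/
abbrev Pairs (K : ℕ) : Type := {p : Fin K × Fin K // p.1 < p.2}

/-- The index set of the pooled sample: `(k, i)` is the `i`-th observation of the `k`-th sample. -/
abbrev Pooled {K : ℕ} (n : Fin K → ℕ) : Type := Σ k : Fin K, Fin (n k)

/-- The smallest sample size. -/
def nMin {K : ℕ} (n : Fin K → ℕ) : ℕ := ⨅ k, n k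

/-- The largest sample size. -/
def nMax {K : ℕ} (n : Fin K → ℕ) : ℕ := ⨆ k, n k

/-- The rate `r_N^⋆ = √(log K / n_min)`. -/
def rate {K : ℕ} (n : Fin K → ℕ) : ℝ := √(Real.log K / nMin n)

section Test

variable {𝒳 : Type*} (H : Type*) [NormedAddCommGroup H] [InnerProductSpace ℝ H] [CompleteSpace H]
  [RKHS ℝ H 𝒳 ℝ]

/-- The test statistic: the maximum over `k < l` of the distance in `H` between the averages of
the features of the `k`-th and of the `l`-th sample. -/
def statMax {K : ℕ} {n : Fin K → ℕ} (z : Pooled n → 𝒳) : ℝ :=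
  ⨆ p : Pairs K,
    ‖(n p.1.1 : ℝ)⁻¹ • ∑ i : Fin (n p.1.1), featureMap H (z ⟨p.1.1, i⟩) -
      (n p.1.2 : ℝ)⁻¹ • ∑ j : Fin (n p.1.2), featureMap H (z ⟨p.1.2, j⟩)‖

open Classical in
/-- The permutation `p`-value: the proportion, among all `N!` permutations `b` of the pooled
sample, of those for which the statistic of the permuted data is at least the observed one. -/
def permPValue {K : ℕ} {n : Fin K → ℕ} (z : Pooled n → 𝒳) : ℝ :=
  1 / ((∑ k, n k).factorial : ℝ) *
    ∑ b : Equiv.Perm (Pooled n), if statMax H (z ∘ b) ≥ statMax H z then (1 : ℝ) else 0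

open Classical in
/-- The exact permutation test `𝟙(p_perm ≤ α)`. -/
def permTest (α : ℝ) {K : ℕ} {n : Fin K → ℕ} (z : Pooled n → 𝒳) : ℕ :=
  if permPValue H z ≤ α then 1 else 0

variable [MeasurableSpace 𝒳]

/-- The class `𝓕_h(ε)` of alternatives: `max_{k < l} 𝒱_h(P_k, P_l) ≥ ε`. -/
def alternatives (K : ℕ) (ε : ℝ) : Set (Fin K → ProbabilityMeasure 𝒳) :=
  {P | ε ≤ ⨆ p : Pairs K, mmd H (P p.1.1 : Measure 𝒳) (P p.1.2 : Measure 𝒳)}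

/-- The joint law of the pooled sample: all observations are independent, and those of the
`k`-th sample have law `P k`. -/
def sampleLaw {K : ℕ} (n : Fin K → ℕ) (P : Fin K → ProbabilityMeasure 𝒳) :
    Measure (Pooled n → 𝒳) :=
  Measure.pi fun s => (P s.1 : Measure 𝒳)

end Test

end KSampleMMD

end

/-!
The test fails to reject only if many permuted statistics reach the observed one. Two facts exclude
this at separation `b r` with `r = √(log K / n_min)` and `b` large, uniformly over the alternatives.

*Permuted statistics are small, for every data set.* The value of `cosh` at the norm satisfies
`(cosh ‖s + v‖ + cosh ‖s - v‖) / 2 ≤ cosh ‖s‖ * cosh ‖v‖` in a Hilbert space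
(`cosh_norm_add_add_cosh_norm_sub_le`). A uniform permutation is invariant under exchanging a point
of one group with a point of another one, which flips the sign of a single summand of a sum of
matched differences; removing the summands one at a time bounds the exponential moments of its norm
(`sum_perm_cosh_norm_sum_sub_le`). Groups of unequal sizes are matched by averaging over cyclic
shifts and Jensen's inequality. Markov's inequality then gives, for each pair of groups, a
sub-Gaussian tail `2 exp (-s ^ 2 n_min / (4 C))` for a kernel with values in `[0, C]`
(`card_perm_le_norm_mean_sub_mean_le`), and a union bound over at most `K ^ 2` pairs shows that the
`p`-value of an observed statistic `≥ s` is at most `2 K ^ 2 exp (-s ^ 2 n_min / (4 C))`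
(`permPValue_le`). For `s = b r / 2` this is `2 K ^ (2 - b ^ 2 / (16 C))`, which tends to `0`
uniformly in `K ≥ 2` as `b → ∞`.

*The observed statistic is at least `b r / 2` with high probability.* It suffices to look at the two
groups that attain the largest discrepancy, so no union bound is needed here: by Chebyshev's
inequality each of their two empirical mean embeddings is within `b r / 4` of its expectation, up to
probability `16 C / (b ^ 2 log 2)` (`sampleLaw_norm_mean_sub_ge_le`). The Hilbert space may be
nonseparable, so the variance is computed through scalar integrals of the kernel only.
-/

namespace KSampleMMD

/-! ### Hyperbolic cosines in a Hilbert space and permutation tails -/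

theorem add_pow_add_sub_pow_le {a d D : ℝ} (hd : |d| ≤ D) (hD : D ≤ a) (k : ℕ) :
    (a + d) ^ k + (a - d) ^ k ≤ (a + D) ^ k + (a - D) ^ k := by
  obtain ⟨h1, h2⟩ := abs_le.1 hd
  rcases (abs_nonneg d |>.trans hd).eq_or_lt with h0 | h0
  · have : d = 0 := by linarith
    simp [this, ← h0]
  have key : ∀ e : ℝ, |e| ≤ D → (a + e) ^ k ≤
      (D + e) / (2 * D) * (a + D) ^ k + (D - e) / (2 * D) * (a - D) ^ k := fun e he => by
    obtain ⟨h1, h2⟩ := abs_le.1 he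
    have hx : a + D ∈ Set.Ici (0 : ℝ) := Set.mem_Ici.2 (by linarith)
    have hy : a - D ∈ Set.Ici (0 : ℝ) := Set.mem_Ici.2 (by linarith)
    have ht : 0 ≤ (D + e) / (2 * D) := div_nonneg (by linarith) (by linarith)
    have ht' : 0 ≤ (D - e) / (2 * D) := div_nonneg (by linarith) (by linarith)
    have := (convexOn_pow (𝕜 := ℝ) k).2 hx hy ht ht' (by field_simp; ring)
    simp only [smul_eq_mul] at this
    have he' : (D + e) / (2 * D) * (a + D) + (D - e) / (2 * D) * (a - D) = a + e := by
      field_simp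
      ring
    rwa [he'] at this
  have e1 := key d hd
  have e2 := key (-d) (by rwa [abs_neg])
  rw [← sub_eq_add_neg] at e2
  refine (add_le_add e1 e2).trans_eq ?_
  field_simp
  ring

section Hilbert

variable {E : Type*} [NormedAddCommGroup E] [InnerProductSpace ℝ E]

/-- With `g u = cosh √u`, the left side is `g (A + d) + g (A - d)` for `A = ‖s‖ ^ 2 + ‖v‖ ^ 2` and
`d = 2 * ⟪s, v⟫`. All power series coefficients of `g` are nonnegative, so `g` is convex and the sum
is largest when `|d| = 2 * ‖s‖ * ‖v‖`, that is, for parallel vectors. -/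
theorem cosh_norm_add_add_cosh_norm_sub_le (s v : E) :
    Real.cosh ‖s + v‖ + Real.cosh ‖s - v‖ ≤ 2 * (Real.cosh ‖s‖ * Real.cosh ‖v‖) := by
  have hrhs : 2 * (Real.cosh ‖s‖ * Real.cosh ‖v‖) =
      Real.cosh (‖s‖ + ‖v‖) + Real.cosh (‖s‖ - ‖v‖) := by
    rw [Real.cosh_add, Real.cosh_sub]; ring
  rw [hrhs]
  refine hasSum_le (fun k => ?_) ((Real.hasSum_cosh _).add (Real.hasSum_cosh _))
    ((Real.hasSum_cosh _).add (Real.hasSum_cosh _))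
  rw [← add_div, ← add_div]
  refine div_le_div_of_nonneg_right ?_ (by positivity)
  simp only [pow_mul]
  have hinner : |2 * inner ℝ s v| ≤ 2 * (‖s‖ * ‖v‖) := by
    rw [abs_mul, abs_two]
    exact mul_le_mul_of_nonneg_left (abs_real_inner_le_norm s v) zero_le_two
  have hle : 2 * (‖s‖ * ‖v‖) ≤ ‖s‖ ^ 2 + ‖v‖ ^ 2 := by
    linarith [two_mul_le_add_sq ‖s‖ ‖v‖]
  have e1 : ‖s + v‖ ^ 2 = ‖s‖ ^ 2 + ‖v‖ ^ 2 + 2 * inner ℝ s v := by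
    rw [norm_add_sq_real]; ring
  have e2 : ‖s - v‖ ^ 2 = ‖s‖ ^ 2 + ‖v‖ ^ 2 - 2 * inner ℝ s v := by
    rw [norm_sub_sq_real]; ring
  have e3 : (‖s‖ + ‖v‖) ^ 2 = ‖s‖ ^ 2 + ‖v‖ ^ 2 + 2 * (‖s‖ * ‖v‖) := by ring
  have e4 : (‖s‖ - ‖v‖) ^ 2 = ‖s‖ ^ 2 + ‖v‖ ^ 2 - 2 * (‖s‖ * ‖v‖) := by ring
  rw [e1, e2, e3, e4]
  exact add_pow_add_sub_pow_le hinner hle k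

/-- Exchanging the values at `p j` and `q j` preserves the uniform law of `σ` and flips the sign of
the `j`-th summand only, so that the summands may be removed one at a time. -/
theorem sum_perm_cosh_norm_sum_sub_le {κ ι : Type*} [Fintype κ] [DecidableEq κ] {w : κ → E} {a : ℝ}
    (hw : ∀ x y, ‖w x - w y‖ ≤ a) {p q : ι → κ} (hp : p.Injective) (hq : q.Injective)
    (hpq : ∀ i j, p i ≠ q j) (S : Finset ι) :
    ∑ σ : Equiv.Perm κ, Real.cosh ‖∑ i ∈ S, (w (σ (p i)) - w (σ (q i)))‖ ≤
      (Fintype.card κ).factorial * Real.cosh a ^ S.card := by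
  classical
  induction S using Finset.induction_on with
  | empty => simp [Fintype.card_perm]
  | insert j S hj ih =>
    set s : Equiv.Perm κ → E := fun σ => ∑ i ∈ S, (w (σ (p i)) - w (σ (q i))) with hs
    set v : Equiv.Perm κ → E := fun σ => w (σ (p j)) - w (σ (q j)) with hv
    have hsum : ∀ σ : Equiv.Perm κ,
        ∑ i ∈ insert j S, (w (σ (p i)) - w (σ (q i))) = s σ + v σ := fun σ => by
      rw [Finset.sum_insert hj, add_comm]
    have hflip : ∑ σ, Real.cosh ‖s σ + v σ‖ = ∑ σ, Real.cosh ‖s σ - v σ‖ := by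
      refine (Fintype.sum_equiv (Equiv.mulRight (Equiv.swap (p j) (q j))) _ _ fun σ => ?_).symm
      have h1 : s (σ * Equiv.swap (p j) (q j)) = s σ := by
        refine Finset.sum_congr rfl fun i hi => ?_
        have hij : i ≠ j := fun h => hj (h ▸ hi)
        rw [Equiv.Perm.mul_apply, Equiv.Perm.mul_apply,
          Equiv.swap_apply_of_ne_of_ne (hp.ne hij) (hpq i j),
          Equiv.swap_apply_of_ne_of_ne (hpq j i).symm (hq.ne hij)]
      have h2 : v (σ * Equiv.swap (p j) (q j)) = -v σ := by
        simp [hv]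
      rw [Equiv.coe_mulRight, h1, h2, sub_eq_add_neg]
    calc ∑ σ : Equiv.Perm κ, Real.cosh ‖∑ i ∈ insert j S, (w (σ (p i)) - w (σ (q i)))‖
        = 2⁻¹ * ∑ σ, (Real.cosh ‖s σ + v σ‖ + Real.cosh ‖s σ - v σ‖) := by
          rw [Finset.sum_add_distrib, ← hflip]
          simp only [hsum]
          ring
      _ ≤ 2⁻¹ * ∑ σ, 2 * (Real.cosh ‖s σ‖ * Real.cosh a) := by
          gcongr with σ
          refine (cosh_norm_add_add_cosh_norm_sub_le _ _).trans ?_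
          gcongr
          refine Real.cosh_le_cosh.2 ?_
          rw [abs_norm]
          exact (hw _ _).trans (le_abs_self a)
      _ = (∑ σ, Real.cosh ‖s σ‖) * Real.cosh a := by
          rw [← Finset.mul_sum, ← Finset.sum_mul]; ring
      _ ≤ _ := by
          rw [Finset.card_insert_of_notMem hj, pow_succ, ← mul_assoc]
          exact mul_le_mul_of_nonneg_right ih (Real.cosh_pos a).le

theorem convexOn_cosh : ConvexOn ℝ Set.univ Real.cosh := by
  have h : Real.cosh = fun x => (2 : ℝ)⁻¹ • (Real.exp x + Real.exp (-x)) := by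
    funext x
    rw [Real.cosh_eq, smul_eq_mul]
    ring
  rw [h]
  refine ConvexOn.smul (by norm_num) (convexOn_exp.add ?_)
  exact convexOn_exp.comp_linearMap (-LinearMap.id)

theorem cosh_norm_average_le {ι : Type*} [Fintype ι] [Nonempty ι] (x : ι → E) :
    Real.cosh ‖(Fintype.card ι : ℝ)⁻¹ • ∑ i, x i‖ ≤
      (Fintype.card ι : ℝ)⁻¹ * ∑ i, Real.cosh ‖x i‖ := by
  have hJ := convexOn_cosh.map_sum_le (t := Finset.univ) (p := fun i => ‖x i‖)
    (w := fun _ : ι => (Fintype.card ι : ℝ)⁻¹) (fun _ _ => by positivity)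
    (by simp [Finset.card_univ]) (fun _ _ => Set.mem_univ _)
  simp only [smul_eq_mul, ← Finset.mul_sum] at hJ
  refine le_trans (Real.cosh_le_cosh.2 ?_) hJ
  rw [abs_norm, abs_of_nonneg (by positivity), norm_smul, Real.norm_of_nonneg (by positivity)]
  gcongr
  exact norm_sum_le _ _

/-- A pair of groups of unequal sizes is reduced to matched pairs: the average over the larger group
is the average, over all cyclic shifts, of averages over as many points as the smaller one has. -/
theorem sum_perm_cosh_norm_mean_sub_mean_le {κ : Type*} [Fintype κ] [DecidableEq κ] {w : κ → E}
    {a : ℝ} (hw : ∀ x y, ‖w x - w y‖ ≤ a) {m M : ℕ} (hm : 0 < m) (hmM : m ≤ M)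
    {p : Fin m → κ} {q : Fin M → κ} (hp : p.Injective) (hq : q.Injective)
    (hpq : ∀ i j, p i ≠ q j) {l : ℝ} (hl : 0 ≤ l) :
    ∑ σ : Equiv.Perm κ,
        Real.cosh (l * ‖(m : ℝ)⁻¹ • ∑ i, w (σ (p i)) - (M : ℝ)⁻¹ • ∑ j, w (σ (q j))‖) ≤
      (Fintype.card κ).factorial * Real.exp (l ^ 2 * a ^ 2 / (2 * m)) := by
  have : NeZero M := ⟨(hm.trans_le hmM).ne'⟩
  have hm' : (0 : ℝ) < m := Nat.cast_pos.2 hm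
  have hM' : (0 : ℝ) < M := Nat.cast_pos.2 (hm.trans_le hmM)
  set u : κ → E := fun x => (l / m) • w x with hu
  have hu' : ∀ x y, ‖u x - u y‖ ≤ l / m * a := fun x y => by
    rw [hu, ← smul_sub, norm_smul, Real.norm_of_nonneg (by positivity)]
    exact mul_le_mul_of_nonneg_left (hw x y) (by positivity)
  have hshift : ∀ σ : Equiv.Perm κ,
      l • ((m : ℝ)⁻¹ • ∑ i, w (σ (p i)) - (M : ℝ)⁻¹ • ∑ j, w (σ (q j))) =
      (Fintype.card (Fin M) : ℝ)⁻¹ • ∑ r : Fin M, ∑ i : Fin m,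
        (u (σ (p i)) - u (σ (q (Fin.castLE hmM i + r)))) := fun σ => by
    have hr : ∀ i : Fin m, ∑ r : Fin M, w (σ (q (Fin.castLE hmM i + r))) = ∑ j, w (σ (q j)) :=
      fun i => Fintype.sum_equiv (Equiv.addLeft (Fin.castLE hmM i)) _ _ fun r => rfl
    rw [Finset.sum_comm]
    simp only [hu, ← Finset.smul_sum, Finset.sum_sub_distrib, hr, Finset.sum_const,
      Finset.card_univ, Fintype.card_fin, ← Nat.cast_smul_eq_nsmul ℝ, smul_smul, smul_sub]
    congr 2 <;> field_simp
  have hexp : Real.cosh (l / m * a) ^ m ≤ Real.exp (l ^ 2 * a ^ 2 / (2 * m)) := by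
    refine (pow_le_pow_left₀ (Real.cosh_pos _).le (Real.cosh_le_exp_half_sq _) m).trans_eq ?_
    rw [← Real.exp_nat_mul]
    congr 1
    field_simp
  calc _ ≤ ∑ σ : Equiv.Perm κ, (Fintype.card (Fin M) : ℝ)⁻¹ * ∑ r : Fin M, Real.cosh
          ‖∑ i : Fin m, (u (σ (p i)) - u (σ (q (Fin.castLE hmM i + r))))‖ := by
        refine Finset.sum_le_sum fun σ _ => ?_
        rw [← Real.norm_of_nonneg hl, ← norm_smul, hshift]
        exact cosh_norm_average_le _
    _ = (M : ℝ)⁻¹ * ∑ r : Fin M, ∑ σ : Equiv.Perm κ, Real.cosh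
          ‖∑ i : Fin m, (u (σ (p i)) - u (σ (q (Fin.castLE hmM i + r))))‖ := by
        rw [← Finset.mul_sum, Finset.sum_comm, Fintype.card_fin]
    _ ≤ (M : ℝ)⁻¹ * ∑ r : Fin M,
          ((Fintype.card κ).factorial * Real.exp (l ^ 2 * a ^ 2 / (2 * m))) := by
        gcongr with r
        refine (sum_perm_cosh_norm_sum_sub_le hu' hp (q := fun i => q (Fin.castLE hmM i + r))
          (fun i j h => ?_) (fun i j => hpq i _) Finset.univ).trans ?_
        · exact Fin.castLE_injective hmM (add_right_cancel (hq h))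
        · rw [Finset.card_univ, Fintype.card_fin]
          gcongr
    _ = _ := by
        rw [Finset.sum_const, Finset.card_univ, Fintype.card_fin, nsmul_eq_mul]
        field_simp

/-- Sub-Gaussian tails of a difference of two group means under a uniform permutation of the points,
in the form of a count of permutations. -/
theorem card_perm_le_norm_mean_sub_mean_le {κ : Type*} [Fintype κ] [DecidableEq κ] {w : κ → E}
    {C : ℝ} (hC : 0 < C) (hw : ∀ x y, ‖w x - w y‖ ^ 2 ≤ 2 * C) {m M : ℕ} (hm : 0 < m) (hM : 0 < M)
    {p : Fin m → κ} {q : Fin M → κ} (hp : p.Injective) (hq : q.Injective)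
    (hpq : ∀ i j, p i ≠ q j) {s : ℝ} (hs : 0 ≤ s) {d : ℕ} (hdm : d ≤ m) (hdM : d ≤ M) :
    (∑ σ : Equiv.Perm κ, if s ≤
        ‖(m : ℝ)⁻¹ • ∑ i, w (σ (p i)) - (M : ℝ)⁻¹ • ∑ j, w (σ (q j))‖ then (1 : ℝ) else 0) ≤
      (Fintype.card κ).factorial * (2 * Real.exp (-(s ^ 2 * d / (4 * C)))) := by
  wlog hmM : m ≤ M generalizing m M
  · have := this hM hm hq hp (fun i j => (hpq j i).symm) hdM hdm (le_of_not_ge hmM)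
    simpa only [norm_sub_rev] using this
  have hm' : (0 : ℝ) < m := Nat.cast_pos.2 hm
  -- the minimizer of `l ^ 2 * C / m - l * s`
  set l : ℝ := s * m / (2 * C) with hl
  have hl0 : 0 ≤ l := by positivity
  have hw' : ∀ x y, ‖w x - w y‖ ≤ √(2 * C) := fun x y => Real.le_sqrt_of_sq_le (hw x y)
  have hmain := sum_perm_cosh_norm_mean_sub_mean_le hw' hm hmM hp hq hpq hl0
  rw [Real.sq_sqrt (by positivity)] at hmain
  have hmarkov : ∀ σ : Equiv.Perm κ,
      (if s ≤ ‖(m : ℝ)⁻¹ • ∑ i, w (σ (p i)) - (M : ℝ)⁻¹ • ∑ j, w (σ (q j))‖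
        then (1 : ℝ) else 0) ≤ 2 * Real.exp (-(l * s)) * Real.cosh
          (l * ‖(m : ℝ)⁻¹ • ∑ i, w (σ (p i)) - (M : ℝ)⁻¹ • ∑ j, w (σ (q j))‖) := fun σ => by
    split_ifs with h
    · have h1 := Real.exp_le_exp.2 (mul_le_mul_of_nonneg_left h hl0)
      have h2 : ∀ x : ℝ, Real.exp x ≤ 2 * Real.cosh x := fun x => by
        rw [Real.cosh_eq]; linarith [Real.exp_pos (-x)]
      calc (1 : ℝ) = Real.exp (-(l * s)) * Real.exp (l * s) := by
            rw [← Real.exp_add]; simp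
        _ ≤ Real.exp (-(l * s)) * (2 * Real.cosh _) := by
            gcongr
            exact h1.trans (h2 _)
        _ = _ := by ring
    · have := Real.cosh_pos
        (l * ‖(m : ℝ)⁻¹ • ∑ i, w (σ (p i)) - (M : ℝ)⁻¹ • ∑ j, w (σ (q j))‖)
      positivity
  refine (Finset.sum_le_sum fun σ _ => hmarkov σ).trans ?_
  rw [← Finset.mul_sum]
  refine (mul_le_mul_of_nonneg_left hmain (by positivity)).trans ?_
  have hexp : Real.exp (-(l * s)) * Real.exp (l ^ 2 * (2 * C) / (2 * m)) ≤
      Real.exp (-(s ^ 2 * d / (4 * C))) := by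
    rw [← Real.exp_add, Real.exp_le_exp]
    have : -(l * s) + l ^ 2 * (2 * C) / (2 * m) = -(s ^ 2 * m / (4 * C)) := by
      rw [hl]; field_simp; ring
    rw [this]
    gcongr
  calc _ = (Fintype.card κ).factorial * (2 * (Real.exp (-(l * s)) *
          Real.exp (l ^ 2 * (2 * C) / (2 * m)))) := by ring
    _ ≤ _ := by gcongr

end Hilbert

/-! ### The permutation p-value -/

section Permutation

variable {𝒳 : Type*} {H : Type*} [NormedAddCommGroup H] [InnerProductSpace ℝ H] [CompleteSpace H]
  [RKHS ℝ H 𝒳 ℝ] {C : ℝ}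

theorem norm_featureMap_sq (x : 𝒳) : ‖featureMap H x‖ ^ 2 = kernelFun H x x := by
  rw [← real_inner_self_eq_norm_sq, ← kernelFun_eq_inner]

theorem norm_featureMap_sub_sq_le (hC : ∀ x y : 𝒳, 0 ≤ kernelFun H x y ∧ kernelFun H x y ≤ C)
    (x y : 𝒳) : ‖featureMap H x - featureMap H y‖ ^ 2 ≤ 2 * C := by
  rw [norm_sub_sq_real, norm_featureMap_sq, norm_featureMap_sq, ← kernelFun_eq_inner]
  linarith [(hC x x).2, (hC y y).2, (hC x y).1]

theorem inner_featureMap_sub_sub (m : H) (x y : 𝒳) :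
    inner ℝ (featureMap H x - m) (featureMap H y - m) =
      kernelFun H x y - m x - m y + inner ℝ m m := by
  rw [inner_sub_left, inner_sub_right, inner_sub_right, ← kernelFun_eq_inner,
    real_inner_comm (featureMap H y) m, inner_featureMap, inner_featureMap]
  ring

theorem norm_inner_featureMap_sub_le (hC : ∀ x : 𝒳, kernelFun H x x ≤ C) (m : H) (x y : 𝒳) :
    ‖(inner ℝ (featureMap H x - m) (featureMap H y - m) : ℝ)‖ ≤ (√C + ‖m‖) ^ 2 := by
  have h : ∀ x : 𝒳, ‖featureMap H x - m‖ ≤ √C + ‖m‖ := fun x => by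
    refine (norm_sub_le _ _).trans (add_le_add_left ?_ _)
    refine Real.le_sqrt_of_sq_le ?_
    rw [norm_featureMap_sq]
    exact hC x
  rw [sq]
  exact (norm_inner_le_norm _ _).trans
    (mul_le_mul (h x) (h y) (norm_nonneg _) ((norm_nonneg _).trans (h x)))

theorem nMin_le {K : ℕ} (n : Fin K → ℕ) (k : Fin K) : nMin n ≤ n k :=
  ciInf_le (OrderBot.bddBelow _) k

theorem nMin_pos {K : ℕ} (hK : 2 ≤ K) {n : Fin K → ℕ} (hn : ∀ k, 0 < n k) : 0 < nMin n := by
  have : Nonempty (Fin K) := ⟨⟨0, by omega⟩⟩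
  obtain ⟨k, hk⟩ := exists_eq_ciInf_of_finite (f := n)
  rw [nMin, ← hk]
  exact hn k

theorem nonempty_pairs {K : ℕ} (hK : 2 ≤ K) : Nonempty (Pairs K) :=
  ⟨⟨(⟨0, by omega⟩, ⟨1, by omega⟩), by simp [Fin.lt_def]⟩⟩

theorem le_statMax {K : ℕ} {n : Fin K → ℕ} (z : Pooled n → 𝒳) (p : Pairs K) :
    ‖(n p.1.1 : ℝ)⁻¹ • ∑ i : Fin (n p.1.1), featureMap H (z ⟨p.1.1, i⟩) -
      (n p.1.2 : ℝ)⁻¹ • ∑ j : Fin (n p.1.2), featureMap H (z ⟨p.1.2, j⟩)‖ ≤ statMax H z :=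
  le_ciSup (f := fun p : Pairs K =>
    ‖(n p.1.1 : ℝ)⁻¹ • ∑ i : Fin (n p.1.1), featureMap H (z ⟨p.1.1, i⟩) -
      (n p.1.2 : ℝ)⁻¹ • ∑ j : Fin (n p.1.2), featureMap H (z ⟨p.1.2, j⟩)‖)
    (Set.finite_range _).bddAbove p

/-- Whatever the data, an observed statistic of size at least `s` has a small `p`-value: a union
bound over the pairs of groups. -/
theorem permPValue_le (hC0 : 0 < C)
    (hC : ∀ x y : 𝒳, 0 ≤ kernelFun H x y ∧ kernelFun H x y ≤ C) {K : ℕ} (hK : 2 ≤ K)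
    {n : Fin K → ℕ} (hn : ∀ k, 0 < n k) (z : Pooled n → 𝒳) {s : ℝ} (hs : 0 ≤ s)
    (hz : s ≤ statMax H z) :
    permPValue H z ≤ (K : ℝ) ^ 2 * (2 * Real.exp (-(s ^ 2 * nMin n / (4 * C)))) := by
  classical
  have := nonempty_pairs hK
  set T : Equiv.Perm (Pooled n) → Pairs K → ℝ := fun b p =>
    ‖(n p.1.1 : ℝ)⁻¹ • ∑ i : Fin (n p.1.1), featureMap H (z (b ⟨p.1.1, i⟩)) -
      (n p.1.2 : ℝ)⁻¹ • ∑ j : Fin (n p.1.2), featureMap H (z (b ⟨p.1.2, j⟩))‖ with hT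
  -- `b ↦ statMax H (z ∘ b)` is `b ↦ ⨆ p, T b p`, and the supremum is attained at some pair
  have hunion : ∀ b : Equiv.Perm (Pooled n),
      (if statMax H (z ∘ b) ≥ statMax H z then (1 : ℝ) else 0) ≤
        ∑ p : Pairs K, if s ≤ T b p then (1 : ℝ) else 0 := fun b => by
    have hnn : ∀ p : Pairs K, (0 : ℝ) ≤ if s ≤ T b p then (1 : ℝ) else 0 := fun p => by
      split_ifs <;> norm_num
    split_ifs with h
    · obtain ⟨p, hp⟩ := exists_eq_ciSup_of_finite (f := T b)
      have hsp : s ≤ T b p := by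
        rw [hp]
        exact hz.trans h
      refine le_trans ?_ (Finset.single_le_sum (fun p _ => hnn p) (Finset.mem_univ p))
      rw [if_pos hsp]
    · exact Finset.sum_nonneg fun p _ => hnn p
  have hcardN : (∑ k, n k) = Fintype.card (Pooled n) := by simp
  have hcardP : (Fintype.card (Pairs K) : ℝ) ≤ (K : ℝ) ^ 2 := by
    have : Fintype.card (Pairs K) ≤ K ^ 2 := by
      refine (Fintype.card_subtype_le _).trans ?_
      rw [Fintype.card_prod, Fintype.card_fin, sq]
    exact_mod_cast this
  have hfac : (0 : ℝ) < (Fintype.card (Pooled n)).factorial :=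
    Nat.cast_pos.2 (Nat.factorial_pos _)
  have hpair : ∀ p : Pairs K, (∑ b, if s ≤ T b p then (1 : ℝ) else 0) ≤
      (Fintype.card (Pooled n)).factorial *
        (2 * Real.exp (-(s ^ 2 * nMin n / (4 * C)))) := fun p => by
    refine card_perm_le_norm_mean_sub_mean_le (w := fun x => featureMap H (z x)) hC0
      (fun x y => norm_featureMap_sub_sq_le hC _ _) (hn _) (hn _)
      (p := fun i => (⟨p.1.1, i⟩ : Pooled n)) (q := fun j => (⟨p.1.2, j⟩ : Pooled n))
      (fun i j h => by simpa using h) (fun i j h => by simpa using h) (fun i j h => ?_) hs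
      (nMin_le n _) (nMin_le n _)
    exact p.2.ne (congrArg Sigma.fst h)
  rw [permPValue, hcardN, one_div, inv_mul_le_iff₀ hfac]
  calc _ ≤ ∑ b, ∑ p : Pairs K, if s ≤ T b p then (1 : ℝ) else 0 :=
        Finset.sum_le_sum fun b _ => hunion b
    _ = ∑ p : Pairs K, ∑ b, if s ≤ T b p then (1 : ℝ) else 0 := Finset.sum_comm
    _ ≤ ∑ _p : Pairs K, (Fintype.card (Pooled n)).factorial *
          (2 * Real.exp (-(s ^ 2 * nMin n / (4 * C)))) := Finset.sum_le_sum fun p _ => hpair p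
    _ = (Fintype.card (Pairs K) : ℝ) * ((Fintype.card (Pooled n)).factorial *
          (2 * Real.exp (-(s ^ 2 * nMin n / (4 * C))))) := by
        rw [Finset.sum_const, Finset.card_univ, nsmul_eq_mul]
    _ ≤ (K : ℝ) ^ 2 * ((Fintype.card (Pooled n)).factorial *
          (2 * Real.exp (-(s ^ 2 * nMin n / (4 * C))))) := by gcongr
    _ = _ := by ring

end Permutation

/-! ### Sampling error and power -/

section Sampling

variable {𝒳 : Type*} {H : Type*} [NormedAddCommGroup H] [InnerProductSpace ℝ H] [CompleteSpace H]
  [RKHS ℝ H 𝒳 ℝ] [MeasurableSpace 𝒳] {C : ℝ}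

theorem integral_inner_featureMap_sub (P : Measure 𝒳) [IsProbabilityMeasure P] {m : H}
    (hm : IsMeanEmbedding P m) (f : H) : ∫ y, inner ℝ f (featureMap H y - m) ∂P = 0 := by
  have h : ∀ y, inner ℝ f (featureMap H y - m) = f y - inner ℝ m f := fun y => by
    rw [inner_sub_right, real_inner_comm, inner_featureMap, real_inner_comm]
  simp only [h]
  rw [integral_sub (hm f).1 (integrable_const _), integral_const, (hm f).2]
  simp

theorem measurable_inner_featureMap_sub (hmeas : Measurable fun p : 𝒳 × 𝒳 => kernelFun H p.1 p.2)
    (m : H) : Measurable fun p : 𝒳 × 𝒳 =>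
      inner ℝ (featureMap H p.1 - m) (featureMap H p.2 - m) := by
  simp only [inner_featureMap_sub_sub]
  have hm := measurable_coe H hmeas m
  exact ((hmeas.sub (hm.comp measurable_fst)).sub (hm.comp measurable_snd)).add_const _

theorem integral_inner_featureMap_sub_self_le (hC : ∀ x : 𝒳, kernelFun H x x ≤ C)
    (hmeas : Measurable fun p : 𝒳 × 𝒳 => kernelFun H p.1 p.2) (P : Measure 𝒳)
    [IsProbabilityMeasure P] {m : H} (hm : IsMeanEmbedding P m) :
    ∫ x, inner ℝ (featureMap H x - m) (featureMap H x - m) ∂P ≤ C := by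
  have h : ∀ x, inner ℝ (featureMap H x - m) (featureMap H x - m) ≤
      C + ‖m‖ ^ 2 - 2 * m x := fun x => by
    rw [inner_featureMap_sub_sub, real_inner_self_eq_norm_sq]
    linarith [hC x]
  have hi : Integrable (fun x => C + ‖m‖ ^ 2 - 2 * m x) P :=
    (integrable_const _).sub ((hm m).1.const_mul 2)
  have hd : Measurable fun x : 𝒳 => (x, x) := measurable_id.prodMk measurable_id
  refine (integral_mono (Integrable.of_bound
    ((measurable_inner_featureMap_sub hmeas m).comp hd).aestronglyMeasurable ((√C + ‖m‖) ^ 2)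
    (ae_of_all _ fun x => norm_inner_featureMap_sub_le hC m x x)) hi h).trans ?_
  rw [integral_sub (integrable_const _) ((hm m).1.const_mul 2), integral_const, integral_const_mul,
    ← (hm m).2, real_inner_self_eq_norm_sq]
  simp
  nlinarith [sq_nonneg ‖m‖]

/-- Coordinates of a product of probability measures are pairwise independent. -/
theorem map_eval_pair_pi {ι : Type*} [Fintype ι] {X : ι → Type*} [∀ i, MeasurableSpace (X i)]
    (μ : ∀ i, Measure (X i)) [∀ i, IsProbabilityMeasure (μ i)] {i j : ι} (hij : i ≠ j) :
    (Measure.pi μ).map (fun z => (z i, z j)) = (μ i).prod (μ j) := by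
  have h := (ProbabilityTheory.iIndepFun_pi (μ := μ) (X := fun _ => id)
    (fun _ => aemeasurable_id)).indepFun hij
  have h' := (ProbabilityTheory.indepFun_iff_map_prod_eq_prod_map_map
    (measurable_pi_apply i).aemeasurable (measurable_pi_apply j).aemeasurable).1 h
  have e : ∀ i, (Measure.pi μ).map (fun z => z i) = μ i := fun i =>
    (measurePreserving_eval μ i).map_eq
  rw [← e i, ← e j]
  exact h'

/-- The mean squared error of the empirical mean embedding of the `k`-th sample. The expectations
are weak ones, so that it is expanded into double integrals of the centred kernel, whose
off-diagonal terms vanish. -/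
theorem integral_norm_mean_sub_meanEmbedding_sq_le (hC : ∀ x : 𝒳, kernelFun H x x ≤ C)
    (hmeas : Measurable fun p : 𝒳 × 𝒳 => kernelFun H p.1 p.2) {K : ℕ} {n : Fin K → ℕ}
    (P : Fin K → ProbabilityMeasure 𝒳) {k : Fin K} (hk : 0 < n k) {m : H}
    (hm : IsMeanEmbedding (P k : Measure 𝒳) m) :
    Integrable (fun z : Pooled n → 𝒳 =>
        ‖(n k : ℝ)⁻¹ • ∑ i, featureMap H (z ⟨k, i⟩) - m‖ ^ 2) (sampleLaw n P) ∧
      ∫ z, ‖(n k : ℝ)⁻¹ • ∑ i, featureMap H (z ⟨k, i⟩) - m‖ ^ 2 ∂sampleLaw n P ≤ C / n k := by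
  have : IsProbabilityMeasure (sampleLaw n P) := by
    unfold sampleLaw; infer_instance
  have hk' : (0 : ℝ) < n k := Nat.cast_pos.2 hk
  set g : 𝒳 × 𝒳 → ℝ := fun p => inner ℝ (featureMap H p.1 - m) (featureMap H p.2 - m) with hg
  have hgm : Measurable g := measurable_inner_featureMap_sub hmeas m
  have hgb : ∀ p, ‖g p‖ ≤ (√C + ‖m‖) ^ 2 := fun p =>
    norm_inner_featureMap_sub_le hC m _ _
  have hexpand : (fun z : Pooled n → 𝒳 =>
      ‖(n k : ℝ)⁻¹ • ∑ i, featureMap H (z ⟨k, i⟩) - m‖ ^ 2) = fun z =>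
        ((n k : ℝ) ^ 2)⁻¹ * ∑ i : Fin (n k), ∑ j : Fin (n k), g (z ⟨k, i⟩, z ⟨k, j⟩) := by
    funext z
    have : (n k : ℝ)⁻¹ • ∑ i, featureMap H (z ⟨k, i⟩) - m =
        (n k : ℝ)⁻¹ • ∑ i, (featureMap H (z ⟨k, i⟩) - m) := by
      rw [Finset.sum_sub_distrib, Finset.sum_const, Finset.card_univ, Fintype.card_fin, smul_sub,
        ← Nat.cast_smul_eq_nsmul ℝ, inv_smul_smul₀ hk'.ne']
    rw [this, norm_smul, mul_pow, Real.norm_of_nonneg (by positivity), inv_pow,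
      ← real_inner_self_eq_norm_sq, sum_inner]
    simp only [inner_sum, hg]
  have hpm : ∀ i j : Fin (n k),
      Measurable fun z : Pooled n → 𝒳 => (z ⟨k, i⟩, z ⟨k, j⟩) := fun i j =>
    (measurable_pi_apply _).prodMk (measurable_pi_apply _)
  have hint : ∀ i j : Fin (n k),
      Integrable (fun z : Pooled n → 𝒳 => g (z ⟨k, i⟩, z ⟨k, j⟩)) (sampleLaw n P) := fun i j =>
    Integrable.of_bound (hgm.comp (hpm i j)).aestronglyMeasurable _ (ae_of_all _ fun z => hgb _)
  have hterm : ∀ i j : Fin (n k),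
      ∫ z : Pooled n → 𝒳, g (z ⟨k, i⟩, z ⟨k, j⟩) ∂sampleLaw n P ≤ if i = j then C else 0 := by
    intro i j
    split_ifs with hij
    · subst hij
      have hmp := measurePreserving_eval (fun s : Pooled n => (P s.1 : Measure 𝒳)) ⟨k, i⟩
      have hd : Measurable fun x : 𝒳 => g (x, x) := hgm.comp (measurable_id.prodMk measurable_id)
      have := integral_map (μ := sampleLaw n P) hmp.measurable.aemeasurable
        hd.aestronglyMeasurable
      rw [sampleLaw, hmp.map_eq] at this
      refine this.symm.trans_le ?_
      exact integral_inner_featureMap_sub_self_le hC hmeas _ hm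
    · have hne : (⟨k, i⟩ : Pooled n) ≠ ⟨k, j⟩ := fun h => hij (by simpa using h)
      have hmap := map_eval_pair_pi (fun s : Pooled n => (P s.1 : Measure 𝒳)) hne
      have := integral_map (hpm i j).aemeasurable
        (hgm.aestronglyMeasurable (μ := Measure.map _ (sampleLaw n P)))
      simp only [sampleLaw] at this ⊢
      rw [hmap] at this
      refine (this.symm.trans ?_).le
      rw [integral_prod _ (Integrable.of_bound hgm.aestronglyMeasurable _ (ae_of_all _ hgb))]
      simp only [hg]
      simp only [integral_inner_featureMap_sub _ hm, integral_zero]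
  rw [hexpand]
  refine ⟨(integrable_finsetSum _ fun i _ => integrable_finsetSum _ fun j _ =>
    hint i j).const_mul _, ?_⟩
  rw [integral_const_mul,
    integral_finsetSum _ fun i _ => integrable_finsetSum _ fun j _ => hint i j]
  simp only [integral_finsetSum _ fun j _ => hint _ j]
  calc _ ≤ ((n k : ℝ) ^ 2)⁻¹ * ∑ i : Fin (n k), ∑ j : Fin (n k), if i = j then C else 0 := by
        gcongr with i _ j _
        exact hterm i j
    _ = C / n k := by
        simp
        field_simp

theorem sampleLaw_norm_mean_sub_ge_le (hC : ∀ x : 𝒳, kernelFun H x x ≤ C)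
    (hmeas : Measurable fun p : 𝒳 × 𝒳 => kernelFun H p.1 p.2) {K : ℕ} {n : Fin K → ℕ}
    (P : Fin K → ProbabilityMeasure 𝒳) {k : Fin K} (hk : 0 < n k) {e : ℝ} (he : 0 < e) :
    sampleLaw n P {z | e ≤ ‖(n k : ℝ)⁻¹ • ∑ i, featureMap H (z ⟨k, i⟩) -
      meanEmbedding H (P k : Measure 𝒳)‖} ≤ ENNReal.ofReal (C / n k / e ^ 2) := by
  have : IsProbabilityMeasure (sampleLaw n P) := by
    unfold sampleLaw; infer_instance
  obtain ⟨hint, hle⟩ := integral_norm_mean_sub_meanEmbedding_sq_le hC hmeas P hk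
    (isMeanEmbedding_meanEmbedding H hC hmeas (P k : Measure 𝒳))
  have hmarkov := mul_meas_ge_le_integral_of_nonneg (ae_of_all _ fun z => sq_nonneg _) hint (e ^ 2)
  have hset : {z : Pooled n → 𝒳 | e ≤ ‖(n k : ℝ)⁻¹ • ∑ i, featureMap H (z ⟨k, i⟩) -
      meanEmbedding H (P k : Measure 𝒳)‖} = {z | e ^ 2 ≤ ‖(n k : ℝ)⁻¹ •
        ∑ i, featureMap H (z ⟨k, i⟩) - meanEmbedding H (P k : Measure 𝒳)‖ ^ 2} := by
    ext z
    exact (pow_le_pow_iff_left₀ he.le (norm_nonneg _) two_ne_zero).symm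
  rw [hset, ← ofReal_measureReal]
  refine ENNReal.ofReal_le_ofReal ?_
  rw [le_div_iff₀ (by positivity), mul_comm]
  exact hmarkov.trans hle

/-- Type II error of the permutation test at separation `b r_N^⋆`, once `b` is so large that the
union bound for the permuted statistics stays below the level. -/
theorem sampleLaw_permTest_eq_zero_le (hC0 : 0 < C)
    (hC : ∀ x y : 𝒳, 0 ≤ kernelFun H x y ∧ kernelFun H x y ≤ C)
    (hmeas : Measurable fun p : 𝒳 × 𝒳 => kernelFun H p.1 p.2) {α : ℝ} {K : ℕ} (hK : 2 ≤ K)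
    {n : Fin K → ℕ} (hn : ∀ k, 0 < n k) {b : ℝ} (hb : 0 < b) (hb2 : 2 ≤ b ^ 2 / (16 * C))
    (hbα : 2 * Real.exp (-((b ^ 2 / (16 * C) - 2) * Real.log 2)) ≤ α)
    {P : Fin K → ProbabilityMeasure 𝒳} (hP : P ∈ alternatives H K (b * rate n)) :
    sampleLaw n P {z | permTest H α z = 0} ≤
      ENNReal.ofReal (32 * C / Real.log 2 / b ^ 2) := by
  have := nonempty_pairs hK
  have hK0 : (0 : ℝ) < K := by
    have : 0 < K := by omega
    exact_mod_cast this
  have hlog2 : 0 < Real.log 2 := Real.log_pos one_lt_two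
  have hlog : Real.log 2 ≤ Real.log K := Real.log_le_log two_pos (by exact_mod_cast hK)
  have hN : (0 : ℝ) < nMin n := Nat.cast_pos.2 (nMin_pos hK hn)
  have hr2 : rate n ^ 2 = Real.log K / nMin n :=
    Real.sq_sqrt (div_nonneg (hlog2.le.trans hlog) hN.le)
  have hr : 0 < rate n := Real.sqrt_pos.2 (div_pos (hlog2.trans_le hlog) hN)
  obtain ⟨p, hp⟩ := exists_eq_ciSup_of_finite
    (f := fun p : Pairs K => mmd H (P p.1.1 : Measure 𝒳) (P p.1.2 : Measure 𝒳))
  have hmmd : b * rate n ≤ mmd H (P p.1.1 : Measure 𝒳) (P p.1.2 : Measure 𝒳) := by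
    simp only [hp]
    exact hP
  set bad : Fin K → Set (Pooled n → 𝒳) := fun k => {z | b * rate n / 4 ≤
    ‖(n k : ℝ)⁻¹ • ∑ i, featureMap H (z ⟨k, i⟩) - meanEmbedding H (P k : Measure 𝒳)‖} with hbad
  have hbadle : ∀ k, sampleLaw n P (bad k) ≤ ENNReal.ofReal (16 * C / Real.log 2 / b ^ 2) :=
    fun k => by
    refine (sampleLaw_norm_mean_sub_ge_le (fun x => (hC x x).2) hmeas P (hn k)
      (e := b * rate n / 4) (by positivity)).trans (ENNReal.ofReal_le_ofReal ?_)
    have hNk : (nMin n : ℝ) ≤ n k := Nat.cast_le.2 (nMin_le n k)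
    have e1 : C / n k / (b * rate n / 4) ^ 2 =
        16 * C / Real.log K / b ^ 2 * (nMin n / n k) := by
      rw [div_pow, mul_pow, hr2]
      have := hlog2.trans_le hlog
      have := hN.trans_le hNk
      field_simp
      norm_num
    rw [e1]
    calc _ ≤ 16 * C / Real.log 2 / b ^ 2 * 1 := by
          gcongr
          exact div_le_one_of_le₀ hNk (by positivity)
      _ = _ := mul_one _
  -- outside the two bad events the statistic is at least `b * rate n / 2`, and the test rejects
  have hsub : {z : Pooled n → 𝒳 | permTest H α z = 0} ⊆ bad p.1.1 ∪ bad p.1.2 := by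
    intro z hz
    by_contra hnot
    simp only [hbad, Set.mem_union, Set.mem_ofPred_eq, not_or, not_le] at hnot
    have hstat : b * rate n / 2 ≤ statMax H z := by
      refine le_trans ?_ (le_statMax z p)
      have htri : ∀ x y u v : H, ‖u - v‖ ≤ ‖x - u‖ + ‖x - y‖ + ‖y - v‖ := fun x y u v => by
        have : u - v = -(x - u) + (x - y) + (y - v) := by abel
        rw [this]
        refine (norm_add_le _ _).trans (add_le_add_left ((norm_add_le _ _).trans ?_) _)
        rw [norm_neg]
      have := htri ((n p.1.1 : ℝ)⁻¹ • ∑ i : Fin (n p.1.1), featureMap H (z ⟨p.1.1, i⟩))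
        ((n p.1.2 : ℝ)⁻¹ • ∑ j : Fin (n p.1.2), featureMap H (z ⟨p.1.2, j⟩))
        (meanEmbedding H (P p.1.1 : Measure 𝒳)) (meanEmbedding H (P p.1.2 : Measure 𝒳))
      rw [mmd] at hmmd
      linarith [hnot.1, hnot.2]
    have hpv := permPValue_le hC0 hC hK hn z (by positivity) hstat
    have hexp : (K : ℝ) ^ 2 * (2 * Real.exp (-((b * rate n / 2) ^ 2 * nMin n / (4 * C)))) ≤ α := by
      refine le_trans ?_ hbα
      have e1 : (b * rate n / 2) ^ 2 * nMin n / (4 * C) = b ^ 2 / (16 * C) * Real.log K := by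
        rw [div_pow, mul_pow, hr2]
        field_simp
        ring
      have e2 : (K : ℝ) ^ 2 = Real.exp (2 * Real.log K) := by
        rw [mul_comm, Real.exp_mul, Real.exp_log hK0]
        norm_num
      rw [e1, e2, mul_left_comm, ← Real.exp_add]
      gcongr
      nlinarith [mul_nonneg (sub_nonneg.2 hb2) (sub_nonneg.2 hlog)]
    have : permTest H α z = 1 := if_pos (hpv.trans hexp)
    rw [Set.mem_ofPred_eq, this] at hz
    exact one_ne_zero hz
  refine (measure_mono hsub).trans ((measure_union_le _ _).trans
    ((add_le_add (hbadle _) (hbadle _)).trans_eq ?_))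
  rw [← ENNReal.ofReal_add (by positivity) (by positivity)]
  congr 1
  ring

end Sampling

end KSampleMMD

theorem theorem5 {𝒳 : Type*} [MeasurableSpace 𝒳]
    (H : Type*) [NormedAddCommGroup H] [InnerProductSpace ℝ H] [CompleteSpace H] [RKHS ℝ H 𝒳 ℝ]
    (hmeas : Measurable fun p : 𝒳 × 𝒳 => KSampleMMD.kernelFun H p.1 p.2)
    (B : ℝ) (hB : ∀ x y : 𝒳, 0 ≤ KSampleMMD.kernelFun H x y ∧ KSampleMMD.kernelFun H x y ≤ B)
    (α : ℝ) (hα : 0 < α) (hα' : α < 1)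
    (K : ℕ → ℕ) (hK : ∀ t, 2 ≤ K t)
    (n : (t : ℕ) → Fin (K t) → ℕ) (hn : ∀ t k, 0 < n t k)
    (c : ℝ) (hc : 0 < c)
    (hbal : ∀ t, (KSampleMMD.nMax (n t) : ℝ) / (KSampleMMD.nMin (n t) : ℝ) ≤ c)
    (hmin : Tendsto (fun t => KSampleMMD.nMin (n t)) atTop atTop)
    (b : ℕ → ℝ) (hb : Tendsto b atTop atTop) :
    limsup (fun t : ℕ =>
        ⨆ P ∈ KSampleMMD.alternatives H (K t) (b t * KSampleMMD.rate (n t)),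
          KSampleMMD.sampleLaw (n t) P {z | KSampleMMD.permTest H α z = 0}) atTop = (0 : ℝ≥0∞) := by
  -- the bound is enlarged to a positive one, to be divided by
  have hC : ∀ x y : 𝒳, 0 ≤ KSampleMMD.kernelFun H x y ∧ KSampleMMD.kernelFun H x y ≤ max B 1 :=
    fun x y => ⟨(hB x y).1, (hB x y).2.trans (le_max_left B 1)⟩
  have hC0 : 0 < max B 1 := lt_max_of_lt_right one_pos
  have hlog2 : 0 < Real.log 2 := Real.log_pos one_lt_two
  have hb2 : Tendsto (fun t => b t ^ 2) atTop atTop := (tendsto_pow_atTop two_ne_zero).comp hb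
  have hbC : Tendsto (fun t => b t ^ 2 / (16 * max B 1)) atTop atTop :=
    hb2.atTop_div_const (by positivity)
  have hexp : Tendsto (fun t => 2 * Real.exp (-((b t ^ 2 / (16 * max B 1) - 2) * Real.log 2)))
      atTop (𝓝 0) := by
    have := (Real.tendsto_exp_neg_atTop_nhds_zero.comp
      ((tendsto_atTop_add_const_right _ (-2) hbC).atTop_mul_const hlog2)).const_mul 2
    rw [mul_zero] at this
    exact this
  have hbound : Tendsto (fun t => ENNReal.ofReal (32 * max B 1 / Real.log 2 / b t ^ 2))
      atTop (𝓝 0) := by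
    rw [← ENNReal.ofReal_zero]
    exact ENNReal.tendsto_ofReal (hb2.const_div_atTop _)
  refine Tendsto.limsup_eq (tendsto_of_tendsto_of_tendsto_of_le_of_le' tendsto_const_nhds hbound
    (Eventually.of_forall fun _ => zero_le) ?_)
  filter_upwards [hb.eventually_gt_atTop 0, hbC.eventually_ge_atTop 2,
    hexp.eventually_le_const hα] with t hbt hbt2 hbα
  exact iSup₂_le fun P hP => KSampleMMD.sampleLaw_permTest_eq_zero_le hC0 hC hmeas (hK t) (hn t)
    hbt hbt2 hbα hP
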